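/- Fix function symbols over $\mathbb R$ that include binary multiplication $\cdot$ and a unary symbol $\sigma$ denoting the sigmoid $\sigma(x)=1/(1+e^{-x})$. All these source symbols denote differentiable maps, and each partial derivative of a source symbol $f$ is denoted by some function symbol $\partial_i f$. Write $\underline r$ for the numeral of $r\in\mathbb R$. In the simply typed $\lambda$-calculus with ground type $\mathsf R$, products, explicit substitutions, numerals, $+$ and these symbols, consider $$L:=\lambda x.\lambda h.\,\sigma(\epsilon\cdot x+\rho\cdot h),\qquad N:=\lambda l.\,l\,L\,\underline 0,$$ with free variables $\epsilon,\rho:\mathsf R$. For $n\ge 0$ and reals $a_1,\dots,a_n$, consider the Church list $$l:=[\underline{a_1};\dots;\underline{a_n}]=\lambda f.\lambda x.\,f\,\underline{a_1}\,(f\,\underline{a_2}\cdots(f\,\underline{a_n}\,x)\cdots).$$ Let $\llbracket Nl\rrbracket:\mathbb R^2\to\mathbb R$ be the function of $(\epsilon,\rho)$ denoted by $Nl$ in the set-theoretic model. Write $\nabla t(e,r)$ for the pair of numerals of the two partial derivatives of $\llbracket t\rrbracket$ at $(e,r)$. For $e,r\in\mathbb R$ and $0\le i<n$ define $$u_0=0,\quad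 u_{i+1}=\sigma(e\,a_{n-i}+r\,u_i),\qquad \sigma'_{i+1}=\sigma'(e\,a_{n-i}+r\,u_i),$$ $$g^0_\epsilon=0,\quad g^{i+1}_\epsilon=\sigma'_{i+1}\,(a_{n-i}+r\,g^i_\epsilon),\qquad g^0_\rho=0,\quad g^{i+1}_\rho=\sigma'_{i+1}\,(u_i+r\,g^i_\rho).$$ **Proposition.** 1. The function $\llbracket Nl\rrbracket$ is differentiable, and $\nabla(Nl)(e,r)=\langle \underline{g^n_\epsilon},\underline{g^n_\rho}\rangle$. 2. This gradient is computed by the reverse gradient transformation. Let $E=\mathbb R^{k}$ with $k\ge1$, and let $\mathsf R^\perp$ be the type of linear maps $\mathbb R\multimap E$. Let $\overleftarrow{\mathbf D}$ be the transformation of types and terms that sends $\mathsf R$ to $\mathsf R\times\mathsf R^\perp$ and commutes with variables, $\lambda$, application, pairs, pair destructuring and explicit substitution. On numerals, sums and function symbols it is given by $$\overleftarrow{\mathbf D}(\underline q)=\langle\underline q,\lambda a.\underline{\mathbf 0}\rangle,\qquad \overleftarrow{\mathbf D}(t+u)=\langle x+y,\lambda a.(x^*a+y^*a)\rangle[\langle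 x,x^*\rangle/\overleftarrow{\mathbf D}(t)][\langle y,y^*\rangle/\overleftarrow{\mathbf D}(u)],$$ $$\overleftarrow{\mathbf D}(f(t_1,\dots,t_m))=\langle f(\mathbf x),\lambda a.\textstyle\sum_{i} x_i^*(\partial_i f(\mathbf x)\cdot a)\rangle[\langle x_1,x_1^*\rangle/\overleftarrow{\mathbf D}(t_1)]\cdots[\langle x_m,x_m^*\rangle/\overleftarrow{\mathbf D}(t_m)].$$ Then, for free variables $\epsilon^*,\rho^*:\mathsf R^\perp$, there is a set $J\subseteq\{\epsilon,\rho\}$, independent of $k$, with $g^n_j=0$ for $j\notin J$, such that $$(z^*\underline 1)\big[\langle z,z^*\rangle/\overleftarrow{\mathbf D}(Nl)[\epsilon/\langle\epsilon,\lambda a.\epsilon^*a\rangle][\rho/\langle\rho,\lambda a.\rho^*a\rangle]\big][\epsilon/\underline e][\rho/\underline r]\;\to^*\;\sum_{j\in J}j^*\,\underline{g^n_j}.$$ Here $\to$ is reduction, in arbitrary contexts, in the linear substitution calculus with the following rules, where $\alpha,\beta$ stand for lists of explicit substitutions. The evaluation rules are - $(\lambda x.t)\alpha\,u\to t[x/u]\alpha$;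 - $s[\langle x,y\rangle/\langle t,u\rangle\alpha]\to s[x/t][y/u]\alpha$; - replacement, for a value $v$, of one occurrence of $x$ in the scope of $[x/v\alpha]$ by $v$; - removal of $[x/v\alpha]$, leaving $\alpha$, when $v$ is a value and $x$ does not occur; - $t[x/v\alpha]\to t\{v/x\}\alpha$ for a linear variable $x$ and a value $v$; - componentwise addition of pairs, and evaluation of $+$ and of function symbols on numerals. The remaining rules are $\eta$-expansion at arrow, $\mathsf R^\perp$ and product types, and linear factoring $(x\alpha\,t)\beta+(x\alpha' t')\beta'\to x(t+t')\alpha\beta\alpha'\beta'$ for $x:\mathsf R^\perp$. Finite sums are read up to associativity and commutativity of $+$ and up to dropping null summands. -/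

import Mathlib

/-! ### Signatures -/

/-- Function symbols over the reals, indexed by their arity: a set `F` of source symbols, contained
(via `incl`) in a larger set `F'`, such that every symbol of `F` denotes a differentiable map and
has its partial derivatives among the symbols of `F'`.  Multiplication and the sigmoid function
are among the source symbols. -/
structure Signature where
  F : ℕ → Type
  F' : ℕ → Type
  incl : {k : ℕ} → F k → F' k
  sem : {k : ℕ} → F' k → (Fin k → ℝ) → ℝ
  differentiable : ∀ {k : ℕ} (f : F k), Differentiable ℝ (sem (incl f))
  par : {k : ℕ} → F k → Fin k → F' k
  sem_par : ∀ {k : ℕ} (f : F k) (i : Fin k) (v : Fin k → ℝ),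
    sem (par f i) v = deriv (fun s => sem (incl f) (Function.update v i s)) (v i)
  mul : F 2
  sem_mul : ∀ v : Fin 2 → ℝ, sem (incl mul) v = v 0 * v 1
  sig : F 1
  sem_sig : ∀ v : Fin 1 → ℝ, sem (incl sig) v = Real.sigmoid (v 0)

/-! ### The source calculus: simply typed terms with products and explicit substitutions

Terms are intrinsically typed, with de Bruijn variables. -/

/-- Simple types without linear negation. -/
inductive STy : Type
  | R : STy
  | prod : STy → STy → STy
  | arr : STy → STy → STy

/-- `Var Γ A`: a variable of type `A` in the typing context `Γ`. -/
inductive Var : List STy → STy → Type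
  | zero {Γ : List STy} {A : STy} : Var (A :: Γ) A
  | succ {Γ : List STy} {A B : STy} : Var Γ A → Var (B :: Γ) A

/-- The de Bruijn index of a variable. -/
def Var.idx : {Γ : List STy} → {A : STy} → Var Γ A → ℕ
  | _, _, .zero => 0
  | _, _, .succ x => x.idx + 1

/-- `STm S Γ A`: the source terms `t` with `Γ ⊢ t : A`.
`letp t u` is `t[⟨x, y⟩/u]`, where `x` has index `0` and `y` has index `1` in `t`;
`esub t u` is the explicit substitution `t[x/u]`, where `x` has index `0` in `t`. -/
inductive STm (S : Signature) : List STy → STy → Type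
  | var {Γ : List STy} {A : STy} : Var Γ A → STm S Γ A
  | num {Γ : List STy} : ℝ → STm S Γ .R
  | lam {Γ : List STy} {A B : STy} : STm S (A :: Γ) B → STm S Γ (.arr A B)
  | app {Γ : List STy} {A B : STy} : STm S Γ (.arr A B) → STm S Γ A → STm S Γ B
  | pair {Γ : List STy} {A B : STy} : STm S Γ A → STm S Γ B → STm S Γ (.prod A B)
  | letp {Γ : List STy} {A B C : STy} :
      STm S (A :: B :: Γ) C → STm S Γ (.prod A B) → STm S Γ C
  | esub {Γ : List STy} {A C : STy} : STm S (A :: Γ) C → STm S Γ A → STm S Γ C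
  | add {Γ : List STy} : STm S Γ .R → STm S Γ .R → STm S Γ .R
  | fn {Γ : List STy} {k : ℕ} : S.F k → (Fin k → STm S Γ .R) → STm S Γ .R

/-- Interpretation of types as sets. -/
def STy.sem : STy → Type
  | .R => ℝ
  | .prod A B => A.sem × B.sem
  | .arr A B => A.sem → B.sem

/-- Interpretation of typing contexts as products. -/
def Env : List STy → Type
  | [] => Unit
  | A :: Γ => A.sem × Env Γ

def Var.sem : {Γ : List STy} → {A : STy} → Var Γ A → Env Γ → A.sem
  | _, _, .zero, g => g.1
  | _, _, .succ x, g => x.sem g.2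

/-- The denotation of a term in the model of sets and functions. -/
def STm.sem {S : Signature} : {Γ : List STy} → {A : STy} → STm S Γ A → Env Γ → A.sem
  | _, _, .var x, g => x.sem g
  | _, _, .num r, _ => r
  | _, _, .lam t, g => fun a => t.sem (a, g)
  | _, _, .app t u, g => t.sem g (u.sem g)
  | _, _, .pair t u, g => (t.sem g, u.sem g)
  | _, _, .letp t u, g => t.sem ((u.sem g).1, (u.sem g).2, g)
  | _, _, .esub t u, g => t.sem (u.sem g, g)
  | _, _, .add t u, g =>
      let x : ℝ := t.sem g
      let y : ℝ := u.sem g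
      x + y
  | _, _, .fn f ts, g => S.sem (S.incl f) (fun i => (ts i).sem g)

/-- The context `x₁ : R, …, xₙ : R`. -/
abbrev realCtx (n : ℕ) : List STy := List.replicate n .R

/-- The element `(v₁, …, vₙ)` of the interpretation of `x₁ : R, …, xₙ : R`. -/
def realEnv : (n : ℕ) → (Fin n → ℝ) → Env (realCtx n)
  | 0, _ => ()
  | n + 1, v => (v 0, realEnv n (fun i => v i.succ))

/-- The `n`-ary real function denoted by a term `x₁ : R, …, xₙ : R ⊢ t : R`. -/
def STm.realFun {S : Signature} {n : ℕ} (t : STm S (realCtx n) .R) (v : Fin n → ℝ) : ℝ :=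
  t.sem (realEnv n v)

/-! ### The target calculus: adding linear negation and linear variables

Raw terms, with de Bruijn variables and annotated binders. -/

/-- Types. The Euclidean type `euc d` below is `R^(d+1)`, and `neg d` is the linear negation
`R ⊸ R^(d+1)`. -/
inductive Ty : Type
  | R : Ty
  | prod : Ty → Ty → Ty
  | arr : Ty → Ty → Ty
  | neg : ℕ → Ty

/-- `euc d` is the Euclidean type `R^(d+1) = R × (⋯ × R)`. -/
def euc : ℕ → Ty
  | 0 => .R
  | d + 1 => .prod .R (euc d)

/-- Annotations of variables: exponential of type `A`, or linear (of type `R`). -/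
inductive Ann : Type
  | exp : Ty → Ann
  | lin : Ann

/-- `lam a t` is `λ x^a. t`; `letp A B t u` is `t[⟨x^A, y^B⟩/u]`, where `x` has index `0` and `y` has
index `1` in `t`; `esub a t u` is `t[x^a/u]`. -/
inductive Tm (S : Signature) : Type
  | var : ℕ → Tm S
  | num : ℝ → Tm S
  | lam : Ann → Tm S → Tm S
  | app : Tm S → Tm S → Tm S
  | pair : Tm S → Tm S → Tm S
  | letp : Ty → Ty → Tm S → Tm S → Tm S
  | esub : Ann → Tm S → Tm S → Tm S
  | add : Tm S → Tm S → Tm S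
  | fn : {k : ℕ} → S.F' k → (Fin k → Tm S) → Tm S

/-- Going under one binder with a renaming. -/
def liftR (ξ : ℕ → ℕ) : ℕ → ℕ
  | 0 => 0
  | i + 1 => ξ i + 1

/-- Going under `m` binders with a renaming. -/
def liftRN : ℕ → (ℕ → ℕ) → ℕ → ℕ
  | 0, ξ => ξ
  | m + 1, ξ => liftR (liftRN m ξ)

namespace Tm

variable {S : Signature}

/-- Renaming of free variables. -/
def ren : (ℕ → ℕ) → Tm S → Tm S
  | ξ, var i => var (ξ i)
  | _, num r => num r
  | ξ, lam a t => lam a (ren (liftR ξ) t)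
  | ξ, app t u => app (ren ξ t) (ren ξ u)
  | ξ, pair t u => pair (ren ξ t) (ren ξ u)
  | ξ, letp A B t u => letp A B (ren (liftR (liftR ξ)) t) (ren ξ u)
  | ξ, esub a t u => esub a (ren (liftR ξ) t) (ren ξ u)
  | ξ, add t u => add (ren ξ t) (ren ξ u)
  | ξ, fn f ts => fn f (fun i => ren ξ (ts i))

/-- Weakening by `m` variables. -/
def shift (m : ℕ) (t : Tm S) : Tm S := ren (fun i => i + m) t

/-- Going under one binder with a substitution. -/
def liftS (s : ℕ → Tm S) : ℕ → Tm S
  | 0 => var 0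
  | i + 1 => shift 1 (s i)

/-- Capture-avoiding simultaneous substitution. -/
def sub : (ℕ → Tm S) → Tm S → Tm S
  | s, var i => s i
  | _, num r => num r
  | s, lam a t => lam a (sub (liftS s) t)
  | s, app t u => app (sub s t) (sub s u)
  | s, pair t u => pair (sub s t) (sub s u)
  | s, letp A B t u => letp A B (sub (liftS (liftS s)) t) (sub s u)
  | s, esub a t u => esub a (sub (liftS s) t) (sub s u)
  | s, add t u => add (sub s t) (sub s u)
  | s, fn f ts => fn f (fun i => sub s (ts i))

/-- `inst v t` is `t{v/x}`, where `x` is the variable of index `0`. -/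
def inst (v t : Tm S) : Tm S :=
  sub (fun i => match i with
    | 0 => v
    | i + 1 => var i) t

/-- `t · u`. -/
def mul (t u : Tm S) : Tm S := fn (S.incl S.mul) ![t, u]

/-- The tuple `⟨t₀, …, tₙ⟩`, nested to the right. -/
def tuple : (n : ℕ) → (Fin (n + 1) → Tm S) → Tm S
  | 0, ts => ts 0
  | n + 1, ts => pair (ts 0) (tuple n (fun i => ts i.succ))

/-- The null vector of `R^(d+1)`. -/
def zeroVec (d : ℕ) : Tm S := tuple d (fun _ => num 0)

/-- A finite sum of terms of type `R^(d+1)`; the empty sum is the null vector. -/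
def sum (d : ℕ) : List (Tm S) → Tm S
  | [] => zeroVec d
  | [t] => t
  | t :: u :: ts => add t (sum d (u :: ts))

/-- Values. -/
inductive IsValue : Tm S → Prop
  | var (i : ℕ) : IsValue (var i)
  | num (r : ℝ) : IsValue (num r)
  | lam (a : Ann) (t : Tm S) : IsValue (lam a t)
  | pair {v w : Tm S} : IsValue v → IsValue w → IsValue (pair v w)

/-- `Repl i v t t'`: the term `t'` is obtained from `t` by replacing exactly one free occurrence of
the variable `i` by `v`. -/
inductive Repl : ℕ → Tm S → Tm S → Tm S → Prop
  | here {i : ℕ} {v : Tm S} : Repl i v (var i) v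
  | lam {i : ℕ} {v : Tm S} {a : Ann} {t t' : Tm S} :
      Repl (i + 1) (shift 1 v) t t' → Repl i v (lam a t) (lam a t')
  | app_left {i : ℕ} {v t t' u : Tm S} : Repl i v t t' → Repl i v (app t u) (app t' u)
  | app_right {i : ℕ} {v t u u' : Tm S} : Repl i v u u' → Repl i v (app t u) (app t u')
  | pair_left {i : ℕ} {v t t' u : Tm S} : Repl i v t t' → Repl i v (pair t u) (pair t' u)
  | pair_right {i : ℕ} {v t u u' : Tm S} : Repl i v u u' → Repl i v (pair t u) (pair t u')
  | letp_body {i : ℕ} {v : Tm S} {A B : Ty} {t t' u : Tm S} :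
      Repl (i + 2) (shift 2 v) t t' → Repl i v (letp A B t u) (letp A B t' u)
  | letp_arg {i : ℕ} {v : Tm S} {A B : Ty} {t u u' : Tm S} :
      Repl i v u u' → Repl i v (letp A B t u) (letp A B t u')
  | esub_body {i : ℕ} {v : Tm S} {a : Ann} {t t' u : Tm S} :
      Repl (i + 1) (shift 1 v) t t' → Repl i v (esub a t u) (esub a t' u)
  | esub_arg {i : ℕ} {v : Tm S} {a : Ann} {t u u' : Tm S} :
      Repl i v u u' → Repl i v (esub a t u) (esub a t u')
  | add_left {i : ℕ} {v t t' u : Tm S} : Repl i v t t' → Repl i v (add t u) (add t' u)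
  | add_right {i : ℕ} {v t u u' : Tm S} : Repl i v u u' → Repl i v (add t u) (add t u')
  | fn {i : ℕ} {v : Tm S} {k : ℕ} {f : S.F' k} {ts : Fin k → Tm S} {j : Fin k} {t' : Tm S} :
      Repl i v (ts j) t' → Repl i v (fn f ts) (fn f (Function.update ts j t'))

/-- `HasTy Γ z t A` is the typing judgement `Γ ⊢ t : A` if `z = none`, and the judgement
`Γ ⊢_z t : A` with linear variable `i` if `z = some i`. -/
inductive HasTy : List Ann → Option ℕ → Tm S → Ty → Prop
  | var {Γ : List Ann} {i : ℕ} {A : Ty} :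
      Γ[i]? = some (.exp A) → HasTy Γ none (var i) A
  | lvar {Γ : List Ann} {i : ℕ} :
      Γ[i]? = some .lin → HasTy Γ (some i) (var i) .R
  | num {Γ : List Ann} {r : ℝ} : HasTy Γ none (num r) .R
  | zero {Γ : List Ann} {i d : ℕ} : HasTy Γ (some i) (zeroVec d) (euc d)
  | pair {Γ : List Ann} {t u : Tm S} {A B : Ty} :
      HasTy Γ none t A → HasTy Γ none u B → HasTy Γ none (pair t u) (.prod A B)
  | lpair {Γ : List Ann} {i d : ℕ} {t u : Tm S} :
      HasTy Γ (some i) t .R → HasTy Γ (some i) u (euc d) →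
      HasTy Γ (some i) (pair t u) (euc (d + 1))
  | letp {Γ : List Ann} {z : Option ℕ} {t u : Tm S} {A B C : Ty} :
      HasTy Γ none u (.prod A B) →
      HasTy (.exp A :: .exp B :: Γ) (z.map fun i => i + 2) t C → HasTy Γ z (letp A B t u) C
  | lam {Γ : List Ann} {t : Tm S} {A B : Ty} :
      HasTy (.exp A :: Γ) none t B → HasTy Γ none (lam (.exp A) t) (.arr A B)
  | app {Γ : List Ann} {t u : Tm S} {A B : Ty} :
      HasTy Γ none t (.arr A B) → HasTy Γ none u A → HasTy Γ none (app t u) B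
  | llam {Γ : List Ann} {t : Tm S} {d : ℕ} :
      HasTy (.lin :: Γ) (some 0) t (euc d) → HasTy Γ none (lam .lin t) (.neg d)
  | lapp {Γ : List Ann} {z : Option ℕ} {t u : Tm S} {d : ℕ} :
      HasTy Γ none t (.neg d) → HasTy Γ z u .R → HasTy Γ z (app t u) (euc d)
  | esub {Γ : List Ann} {z : Option ℕ} {t u : Tm S} {A C : Ty} :
      HasTy Γ none u A → HasTy (.exp A :: Γ) (z.map fun i => i + 1) t C →
      HasTy Γ z (esub (.exp A) t u) C
  | lesub {Γ : List Ann} {z : Option ℕ} {t u : Tm S} {d : ℕ} :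
      HasTy Γ z u .R → HasTy (.lin :: Γ) (some 0) t (euc d) →
      HasTy Γ z (esub .lin t u) (euc d)
  | fn {Γ : List Ann} {k : ℕ} {f : S.F' k} {ts : Fin k → Tm S} :
      (∀ j, HasTy Γ none (ts j) .R) → HasTy Γ none (fn f ts) .R
  | lmul_left {Γ : List Ann} {i : ℕ} {t u : Tm S} :
      HasTy Γ (some i) t .R → HasTy Γ none u .R → HasTy Γ (some i) (mul t u) .R
  | lmul_right {Γ : List Ann} {i : ℕ} {t u : Tm S} :
      HasTy Γ none t .R → HasTy Γ (some i) u .R → HasTy Γ (some i) (mul t u) .R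
  | add {Γ : List Ann} {z : Option ℕ} {t u : Tm S} {d : ℕ} :
      HasTy Γ z t (euc d) → HasTy Γ z u (euc d) → HasTy Γ z (add t u) (euc d)

end Tm

/-! ### Substitution contexts -/

/-- One explicit substitution `[x^a/u]` or `[⟨x^A, y^B⟩/u]`. -/
inductive Entry (S : Signature) : Type
  | one : Ann → Tm S → Entry S
  | two : Ty → Ty → Tm S → Entry S

namespace Entry

variable {S : Signature}

/-- The number of variables bound by an entry. -/
def size : Entry S → ℕ
  | one _ _ => 1
  | two _ _ _ => 2

def ren (ξ : ℕ → ℕ) : Entry S → Entry S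
  | one a u => one a (u.ren ξ)
  | two A B u => two A B (u.ren ξ)

def bind (t : Tm S) : Entry S → Tm S
  | one a u => .esub a t u
  | two A B u => .letp A B t u

end Entry

/-- A substitution context `{·}[p₁/t₁]⋯[pₙ/tₙ]`, as a list with the innermost entry first. -/
abbrev SCtx (S : Signature) : Type := List (Entry S)

namespace SCtx

variable {S : Signature}

/-- The number of variables bound by a substitution context. -/
def size : SCtx S → ℕ
  | [] => 0
  | e :: α => e.size + size α

/-- `plug α t` is `tα`. -/
def plug : SCtx S → Tm S → Tm S
  | [], t => t
  | e :: α, t => plug α (e.bind t)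

/-- Renaming of the free variables of a substitution context. -/
def ren (ξ : ℕ → ℕ) : SCtx S → SCtx S
  | [] => []
  | e :: α => e.ren (liftRN (size α) ξ) :: ren ξ α

/-- The substitution context `αβ` (first `α`, then `β` around it), where the bound variables of `β`
are fresh for `α`. -/
def comp (α β : SCtx S) : SCtx S := ren (fun i => i + size β) α ++ β

/-- The substitution context `α₁⋯αₖ`. -/
def compAll : (k : ℕ) → (Fin k → SCtx S) → SCtx S
  | 0, _ => []
  | k + 1, α => comp (compAll k (fun i => α i.castSucc)) (α (Fin.last k))

end SCtx

/-! ### Reduction -/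

open SCtx in
/-- The root reduction steps `t → u`, for terms whose free variables are annotated by `Γ`. -/
inductive Root {S : Signature} : List Ann → Tm S → Tm S → Prop
  /-- `(λx.t)α u → t[x/u]α` -/
  | beta {Γ : List Ann} (a : Ann) (t u : Tm S) (α : SCtx S) :
      Root Γ (.app (plug α (.lam a t)) u) (plug α (.esub a t (u.shift (size α))))
  /-- `s[⟨x, y⟩/⟨t, u⟩α] → s[x/t][y/u]α` -/
  | unpair {Γ : List Ann} (A B : Ty) (s t u : Tm S) (α : SCtx S) :
      Root Γ (.letp A B s (plug α (.pair t u)))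
        (plug α (.esub (.exp B)
          (.esub (.exp A) (s.ren (liftRN 2 fun i => i + size α)) (t.shift 1)) u))
  /-- `C{x}[x/vα] → C{v}[x/v]α`, for `x` exponential and `v` a value -/
  | subst {Γ : List Ann} (A : Ty) (t t' v : Tm S) (α : SCtx S) :
      v.IsValue → Tm.Repl 0 (v.shift 1) (t.ren (liftR fun i => i + size α)) t' →
      Root Γ (.esub (.exp A) t (plug α v)) (plug α (.esub (.exp A) t' v))
  /-- `t[x/vα] → tα`, for `x` exponential and not free in `t`, and `v` a value -/
  | gc {Γ : List Ann} (A : Ty) (t v : Tm S) (α : SCtx S) :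
      v.IsValue →
      Root Γ (.esub (.exp A) (t.shift 1) (plug α v)) (plug α (t.shift (size α)))
  /-- `t[x/vα] → t{v/x}α`, for `x` linear and `v` a value -/
  | lin {Γ : List Ann} (t v : Tm S) (α : SCtx S) :
      v.IsValue →
      Root Γ (.esub .lin t (plug α v)) (plug α (Tm.inst v (t.ren (liftR fun i => i + size α))))
  /-- `rα + qβ → (r + q)αβ`, for numerals `r` and `q` -/
  | plus {Γ : List Ann} (r q : ℝ) (α β : SCtx S) :
      Root Γ (.add (plug α (.num r)) (plug β (.num q))) (plug (comp α β) (.num (r + q)))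
  /-- `⟨t₁, t₂⟩α + ⟨u₁, u₂⟩β → ⟨t₁ + u₁, t₂ + u₂⟩αβ` -/
  | plusPair {Γ : List Ann} (t₁ t₂ u₁ u₂ : Tm S) (α β : SCtx S) :
      Root Γ (.add (plug α (.pair t₁ t₂)) (plug β (.pair u₁ u₂)))
        (plug (comp α β) (.pair
          (.add (t₁.ren (liftRN (size α) fun i => i + size β)) (u₁.shift (size α)))
          (.add (t₂.ren (liftRN (size α) fun i => i + size β)) (u₂.shift (size α)))))
  /-- `f(r₁α₁, …, rₖαₖ) → f(r₁, …, rₖ)α₁⋯αₖ`, for numerals `rᵢ` and any function symbol `f`,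
  multiplication included -/
  | fn {Γ : List Ann} {k : ℕ} (f : S.F' k) (r : Fin k → ℝ) (α : Fin k → SCtx S) :
      Root Γ (.fn f fun i => plug (α i) (.num (r i)))
        (plug (compAll k α) (.num (S.sem f r)))
  /-- `t → λy.ty`, for `t` of arrow type -/
  | eta {Γ : List Ann} (t : Tm S) (A B : Ty) :
      Tm.HasTy Γ none t (.arr A B) → Root Γ t (.lam (.exp A) (.app (t.shift 1) (.var 0)))
  /-- `t → λy.ty`, for `t` of linear negation type -/
  | etaLin {Γ : List Ann} (t : Tm S) (d : ℕ) :
      Tm.HasTy Γ none t (.neg d) → Root Γ t (.lam .lin (.app (t.shift 1) (.var 0)))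
  /-- `t[x/⟨u, u'⟩] → t[x/⟨y, y'⟩][⟨y, y'⟩/⟨u, u'⟩]` -/
  | etaPair {Γ : List Ann} (A B : Ty) (t u u' : Tm S) :
      Root Γ (.esub (.exp (.prod A B)) t (.pair u u'))
        (.letp A B (.esub (.exp (.prod A B)) (t.ren (liftR fun i => i + 2))
          (.pair (.var 0) (.var 1))) (.pair u u'))
  /-- linear factoring `(xα t)β + (xα' t')β' → x(t + t')αβα'β'`, for `x` of linear negation type -/
  | factor {Γ : List Ann} (x d : ℕ) (t t' : Tm S) (α β α' β' : SCtx S) :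
      Γ[x]? = some (.exp (.neg d)) →
      Root Γ
        (.add (plug β (.app (plug α (.var (x + size β + size α))) t))
          (plug β' (.app (plug α' (.var (x + size β' + size α'))) t')))
        (plug (comp (α ++ β) (α' ++ β'))
          (.app (.var (x + size (α ++ β) + size (α' ++ β')))
            (.add ((t.ren (liftRN (size β) fun i => i + size (α' ++ β'))).shift (size α))
              (t'.shift (size (α ++ β) + size α')))))

/-- The equations that are implicit in writing finite sums `∑ tᵢ` without parentheses:
associativity and commutativity of `+`, and dropping a null summand. -/
inductive SumEq {S : Signature} : List Ann → Tm S → Tm S → Prop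
  | comm {Γ : List Ann} (t u : Tm S) : SumEq Γ (.add t u) (.add u t)
  | assoc {Γ : List Ann} (s t u : Tm S) :
      SumEq Γ (.add (.add s t) u) (.add s (.add t u))
  | zero {Γ : List Ann} (t : Tm S) (d : ℕ) : SumEq Γ (.add t (.zeroVec d)) t

/-- The closure of a relation under arbitrary one-hole contexts. -/
inductive CtxClosure {S : Signature} (P : List Ann → Tm S → Tm S → Prop) :
    List Ann → Tm S → Tm S → Prop
  | root {Γ : List Ann} {t u : Tm S} : P Γ t u → CtxClosure P Γ t u
  | lam {Γ : List Ann} {a : Ann} {t t' : Tm S} :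
      CtxClosure P (a :: Γ) t t' → CtxClosure P Γ (.lam a t) (.lam a t')
  | app_left {Γ : List Ann} {t t' u : Tm S} :
      CtxClosure P Γ t t' → CtxClosure P Γ (.app t u) (.app t' u)
  | app_right {Γ : List Ann} {t u u' : Tm S} :
      CtxClosure P Γ u u' → CtxClosure P Γ (.app t u) (.app t u')
  | pair_left {Γ : List Ann} {t t' u : Tm S} :
      CtxClosure P Γ t t' → CtxClosure P Γ (.pair t u) (.pair t' u)
  | pair_right {Γ : List Ann} {t u u' : Tm S} :
      CtxClosure P Γ u u' → CtxClosure P Γ (.pair t u) (.pair t u')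
  | letp_body {Γ : List Ann} {A B : Ty} {t t' u : Tm S} :
      CtxClosure P (.exp A :: .exp B :: Γ) t t' →
      CtxClosure P Γ (.letp A B t u) (.letp A B t' u)
  | letp_arg {Γ : List Ann} {A B : Ty} {t u u' : Tm S} :
      CtxClosure P Γ u u' → CtxClosure P Γ (.letp A B t u) (.letp A B t u')
  | esub_body {Γ : List Ann} {a : Ann} {t t' u : Tm S} :
      CtxClosure P (a :: Γ) t t' → CtxClosure P Γ (.esub a t u) (.esub a t' u)
  | esub_arg {Γ : List Ann} {a : Ann} {t u u' : Tm S} :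
      CtxClosure P Γ u u' → CtxClosure P Γ (.esub a t u) (.esub a t u')
  | add_left {Γ : List Ann} {t t' u : Tm S} :
      CtxClosure P Γ t t' → CtxClosure P Γ (.add t u) (.add t' u)
  | add_right {Γ : List Ann} {t u u' : Tm S} :
      CtxClosure P Γ u u' → CtxClosure P Γ (.add t u) (.add t u')
  | fn {Γ : List Ann} {k : ℕ} {f : S.F' k} {ts : Fin k → Tm S} {j : Fin k} {t' : Tm S} :
      CtxClosure P Γ (ts j) t' → CtxClosure P Γ (.fn f ts) (.fn f (Function.update ts j t'))

/-- `Reduces Γ t u`: `t →* u`, where finite sums are read up to associativity, commutativity and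
null summands. -/
def Reduces {S : Signature} (Γ : List Ann) : Tm S → Tm S → Prop :=
  Relation.ReflTransGen fun t u => CtxClosure Root Γ t u ∨ CtxClosure SumEq Γ t u

/-! ### The reverse gradient transformation relative to `R^(d+1)` -/

/-- The action on types. -/
def STy.rev (d : ℕ) : STy → Ty
  | .R => .prod .R (.neg d)
  | .prod A B => .prod (A.rev d) (B.rev d)
  | .arr A B => .arr (A.rev d) (B.rev d)

/-- `b[⟨x₁, x₁*⟩/t₁]⋯[⟨xₖ, xₖ*⟩/tₖ]`; in `b`, the variable `xᵢ₊₁` has index `2i` and `xᵢ₊₁*` has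
index `2i + 1`. -/
def letPairs {S : Signature} (d : ℕ) : (k : ℕ) → (Fin k → Tm S) → Tm S → Tm S
  | 0, _, b => b
  | k + 1, ts, b =>
      .letp .R (.neg d) (letPairs d k (fun i => (ts i.castSucc).shift 2) b) (ts (Fin.last k))

/-- The action on terms. For a sum `t + u` it is
`⟨x + y, λa. x* a + y* a⟩[⟨x, x*⟩/t'][⟨y, y*⟩/u']`, and for `f(t₁, …, tₖ)` it is
`⟨f(x₁, …, xₖ), λa. ∑ᵢ xᵢ* (∂ᵢf(x₁, …, xₖ) · a)⟩[⟨x₁, x₁*⟩/t₁']⋯[⟨xₖ, xₖ*⟩/tₖ']`,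
where a prime denotes the transformed term. -/
def STm.rev {S : Signature} (d : ℕ) : {Γ : List STy} → {A : STy} → STm S Γ A → Tm S
  | _, _, .var x => .var x.idx
  | _, _, .num r => .pair (.num r) (.lam .lin (.zeroVec d))
  | _, _, .lam (A := A) t => .lam (.exp (A.rev d)) (t.rev d)
  | _, _, .app t u => .app (t.rev d) (u.rev d)
  | _, _, .pair t u => .pair (t.rev d) (u.rev d)
  | _, _, .letp (A := A) (B := B) t u => .letp (A.rev d) (B.rev d) (t.rev d) (u.rev d)
  | _, _, .esub (A := A) t u => .esub (.exp (A.rev d)) (t.rev d) (u.rev d)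
  | _, _, .add t u =>
      .letp .R (.neg d)
        (.letp .R (.neg d)
          (.pair (.add (.var 0) (.var 2))
            (.lam .lin (.add (.app (.var 2) (.var 0)) (.app (.var 4) (.var 0)))))
          ((t.rev d).shift 2))
        (u.rev d)
  | _, _, .fn (k := k) f ts =>
      letPairs d k (fun i => (ts i).rev d)
        (.pair (.fn (S.incl f) fun j : Fin k => .var (2 * (j : ℕ)))
          (.lam .lin (Tm.sum d ((List.finRange k).map fun i : Fin k =>
            .app (.var (2 * (i : ℕ) + 2))
              (.mul (.fn (S.par f i) fun j : Fin k => .var (2 * (j : ℕ) + 1)) (.var 0))))))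

/-- `t[x₁/u₁]⋯[xₙ/uₙ]` for variables `xᵢ` annotated by `a`; in `t`, `xᵢ₊₁` has index `i`. -/
def esubs {S : Signature} (a : Ann) : (n : ℕ) → (Fin n → Tm S) → Tm S → Tm S
  | 0, _, t => t
  | n + 1, us, t => .esub a (esubs a n (fun i => (us i.castSucc).shift 1) t) (us (Fin.last n))

/-- The program `(z* 1)[⟨z, z*⟩/t'[x₁/⟨x₁, λa. x₁* a⟩]⋯[xₙ/⟨xₙ, λa. xₙ* a⟩]][x₁/r₁]⋯[xₙ/rₙ]`, where `t'`
is the transform of `t`. Its free variables are `x₁*, …, xₙ*`, of type `neg d`, with `xᵢ₊₁*` of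
index `i`. -/
def STm.gradProgram {S : Signature} (d : ℕ) {n : ℕ} (t : STm S (realCtx n) .R)
    (r : Fin n → ℝ) : Tm S :=
  esubs (.exp .R) n (fun i => .num (r i))
    (.letp .R (.neg d) (.app (.var 1) (.num 1))
      (esubs (.exp (STy.R.rev d)) n
        (fun i : Fin n => .pair (.var (i : ℕ)) (.lam .lin (.app (.var (n + (i : ℕ) + 1)) (.var 0))))
        (t.rev d)))

/-- The sum `∑_{j ∈ J} xⱼ* gⱼ`, where `xⱼ₊₁*` has index `j`. -/
def taggedSum {S : Signature} (d : ℕ) {n : ℕ} (J : Finset (Fin n)) (g : Fin n → ℝ) : Tm S :=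
  Tm.sum d (((List.finRange n).filter fun j => j ∈ J).map fun j : Fin n =>
    .app (.var (j : ℕ)) (.num (g j)))

/-- The gradient `∇t(r)`: the tuple of the numerals of the partial derivatives at `r` of the
function denoted by `t`. -/
noncomputable def STm.nabla {S : Signature} {n : ℕ} (t : STm S (realCtx (n + 1)) .R)
    (r : Fin (n + 1) → ℝ) : Tm S :=
  .tuple n fun i => .num (deriv (fun s => t.realFun (Function.update r i s)) (r i))

/-! ### Recurrent neural networks -/

/-- The type of Church lists with entries in `A`. -/
def STy.list (A X : STy) : STy := .arr (.arr A (.arr X X)) (.arr X X)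

/-- The Church list `[a₁; …; aₙ] = λf. λx. f a₁ (f a₂ ⋯ (f aₙ x)⋯)` of numerals. -/
def churchList (S : Signature) (Γ : List STy) (X : STy) (l : List ℝ) : STm S Γ (STy.list .R X) :=
  .lam (.lam (l.foldr (fun a t => .app (.app (.var (.succ .zero)) (.num a)) t) (.var .zero)))

/-- The layer `L = λx. λh. σ(ε · x + ρ · h)`. -/
def layer (S : Signature) {Γ : List STy} (ε ρ : Var Γ .R) : STm S Γ (.arr .R (.arr .R .R)) :=
  .lam (.lam (.fn S.sig ![.add
    (.fn S.mul ![.var (.succ (.succ ε)), .var (.succ .zero)])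
    (.fn S.mul ![.var (.succ (.succ ρ)), .var .zero])]))

/-- The network `N = λl. l L 0`, with free variables `ε` (index `0`) and `ρ` (index `1`). -/
def network (S : Signature) : STm S (realCtx 2) (.arr (STy.list .R .R) .R) :=
  .lam (.app (.app (.var .zero) (layer S (.succ .zero) (.succ (.succ .zero)))) (.num 0))

/-- `N [a₁; …; aₙ]`. -/
def networkApp (S : Signature) (n : ℕ) (a : ℕ → ℝ) : STm S (realCtx 2) .R :=
  .app (network S) (churchList S _ .R ((List.range n).map fun i => a (i + 1)))

noncomputable section

/-- `u₀ = 0` and `uᵢ₊₁ = σ(e aₙ₋ᵢ + r uᵢ)`. -/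
def state (n : ℕ) (a : ℕ → ℝ) (e r : ℝ) : ℕ → ℝ
  | 0 => 0
  | i + 1 => Real.sigmoid (e * a (n - i) + r * state n a e r i)

/-- `dsig i` is `σ'ᵢ₊₁ = σ'(e aₙ₋ᵢ + r uᵢ)`. -/
def dsig (n : ℕ) (a : ℕ → ℝ) (e r : ℝ) (i : ℕ) : ℝ :=
  deriv Real.sigmoid (e * a (n - i) + r * state n a e r i)

/-- The recurrence for the derivative with respect to `ε`. -/
def gradEps (n : ℕ) (a : ℕ → ℝ) (e r : ℝ) : ℕ → ℝ
  | 0 => 0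
  | i + 1 => dsig n a e r i * (a (n - i) + r * gradEps n a e r i)

/-- The recurrence for the derivative with respect to `ρ`. -/
def gradRho (n : ℕ) (a : ℕ → ℝ) (e r : ℝ) : ℕ → ℝ
  | 0 => 0
  | i + 1 => dsig n a e r i * (state n a e r i + r * gradRho n a e r i)

end

/-!
The gradient program of *every* term `t` computes the gradient of the function denoted by `t`, by
a logical relation. Fix a point `r`. At type `R`, a value `⟨v, w⟩` is related to a real function `φ`
that is differentiable at `r` when `v` is the numeral of `φ r` and `w` applied to a numeral `q`
reduces to `∑ⱼ xⱼ* (q · ∂ⱼφ r)`, summed over a set `J` of tags outside of which `∂ⱼφ r` vanishes.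
For a function symbol, the chain rule combines the sums of its arguments, and linear factoring
merges the summands that have the same tag. Products and arrows are treated as usual, so every term
is related to its denotation, and differentiability comes with the relation. The network denotes the
function `(e, r) ↦ uₙ`, and differentiating the recurrence for `uᵢ` gives those for the `gⁱ`.
-/

/-! ### Substitution -/

theorem liftR_id : liftR id = id := by
  funext i; cases i <;> rfl

theorem liftR_comp (ξ ζ : ℕ → ℕ) : liftR ξ ∘ liftR ζ = liftR (ξ ∘ ζ) := by
  funext i; cases i <;> rfl

namespace Tm

variable {S : Signature}

theorem liftS_var : liftS (var : ℕ → Tm S) = var := by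
  funext i; cases i <;> rfl

theorem liftS_comp_liftR (s : ℕ → Tm S) (ξ : ℕ → ℕ) : liftS s ∘ liftR ξ = liftS (s ∘ ξ) := by
  funext i; cases i <;> rfl

theorem ren_id (t : Tm S) : ren id t = t := by
  induction t <;> simp_all [ren, liftR_id]

theorem ren_ren (ξ ζ : ℕ → ℕ) (t : Tm S) : ren ξ (ren ζ t) = ren (ξ ∘ ζ) t := by
  induction t generalizing ξ ζ <;> simp_all [ren, liftR_comp]

theorem sub_ren (s : ℕ → Tm S) (ξ : ℕ → ℕ) (t : Tm S) : sub s (ren ξ t) = sub (s ∘ ξ) t := by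
  induction t generalizing s ξ <;> simp_all [ren, sub, liftS_comp_liftR]

theorem sub_var (t : Tm S) : sub var t = t := by
  induction t <;> simp_all [sub, liftS_var]

theorem ren_comp_liftS (ξ : ℕ → ℕ) (s : ℕ → Tm S) :
    ren (liftR ξ) ∘ liftS s = liftS (ren ξ ∘ s) := by
  funext i
  cases i with
  | zero => rfl
  | succ i => simp only [Function.comp_apply, liftS, shift, ren_ren]; rfl

theorem ren_sub (ξ : ℕ → ℕ) (s : ℕ → Tm S) (t : Tm S) :
    ren ξ (sub s t) = sub (ren ξ ∘ s) t := by
  induction t generalizing s ξ <;> simp_all [ren, sub, ren_comp_liftS]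

theorem sub_comp_liftS (s s' : ℕ → Tm S) : sub (liftS s) ∘ liftS s' = liftS (sub s ∘ s') := by
  funext i
  cases i with
  | zero => rfl
  | succ i => exact (sub_ren _ _ _).trans (ren_sub _ _ _).symm

theorem sub_sub (s s' : ℕ → Tm S) (t : Tm S) : sub s (sub s' t) = sub (sub s ∘ s') t := by
  induction t generalizing s s' <;> simp_all [sub, sub_comp_liftS]

theorem shift_zero (t : Tm S) : shift 0 t = t := ren_id t

theorem shift_one_shift_one (t : Tm S) : shift 1 (shift 1 t) = shift 2 t := ren_ren _ _ _

/-- The substitution `v, s 0, s 1, …`, which extends `s` to one more variable: it substitutes for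
the body of a binder when `s` substitutes for the term around it. -/
def scons (v : Tm S) (s : ℕ → Tm S) : ℕ → Tm S
  | 0 => v
  | i + 1 => s i

theorem inst_eq_sub_scons (v t : Tm S) : inst v t = sub (scons v var) t := by
  unfold inst
  congr 1

theorem sub_scons_shift (v : Tm S) (s : ℕ → Tm S) (t : Tm S) :
    sub (scons v s) (shift 1 t) = sub s t := sub_ren _ _ _

theorem sub_scons_scons_shift (v w : Tm S) (s : ℕ → Tm S) (t : Tm S) :
    sub (scons v (scons w s)) (shift 2 t) = sub s t := sub_ren _ _ _

theorem sub_scons_comp_liftS (v : Tm S) (s s' : ℕ → Tm S) :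
    sub (scons v s) ∘ liftS s' = scons v (sub s ∘ s') := by
  funext i
  cases i with
  | zero => rfl
  | succ i => exact sub_scons_shift v s (s' i)

theorem sub_scons_var_sub_liftS (v : Tm S) (s : ℕ → Tm S) (t : Tm S) :
    sub (scons v var) (sub (liftS s) t) = sub (scons v s) t := by
  rw [sub_sub, sub_scons_comp_liftS]
  congr 2
  exact funext fun i => sub_var (s i)

theorem sub_liftS_scons_var_sub_liftS (w : Tm S) (s : ℕ → Tm S) (t : Tm S) :
    sub (liftS (scons w var)) (sub (liftS (liftS s)) t) = sub (liftS (scons w s)) t := by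
  rw [sub_sub, sub_comp_liftS, sub_scons_comp_liftS]
  congr 3
  exact funext fun i => sub_var (s i)

theorem sub_tuple (s : ℕ → Tm S) (n : ℕ) (ts : Fin (n + 1) → Tm S) :
    sub s (tuple n ts) = tuple n fun i => sub s (ts i) := by
  induction n with
  | zero => rfl
  | succ n ih => simp only [tuple, sub, ih]

theorem sub_zeroVec (s : ℕ → Tm S) (d : ℕ) : sub s (zeroVec d) = zeroVec d := sub_tuple _ _ _

theorem sub_sum (s : ℕ → Tm S) (d : ℕ) (ts : List (Tm S)) :
    sub s (sum d ts) = sum d (ts.map (sub s)) := by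
  induction ts with
  | nil => exact sub_zeroVec s d
  | cons t ts ih => cases ts <;> simp_all [sum, sub]

theorem sub_mul (s : ℕ → Tm S) (t u : Tm S) : sub s (mul t u) = mul (sub s t) (sub s u) := by
  simp only [mul, sub]
  congr 1
  funext i
  fin_cases i <;> rfl

/-! ### Replacing all occurrences of a variable -/

/-- The substitution of `v` for the variable `i`, leaving the other variables alone. Unlike the
substitution in `inst` it does not renumber them, so it is what iterating `Repl i v` computes. -/
def single (i : ℕ) (v : Tm S) : ℕ → Tm S := Function.update var i v

theorem liftS_single (i : ℕ) (v : Tm S) : liftS (single i v) = single (i + 1) (shift 1 v) := by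
  funext j
  cases j with
  | zero => simp [liftS, single]
  | succ j => rcases eq_or_ne j i with rfl | h <;> simp_all [liftS, single, shift, ren]

theorem sub_single_zero_shift (v t : Tm S) :
    sub (single 0 (shift 1 v)) t = shift 1 (sub (scons v var) t) := by
  rw [shift.eq_def 1 (sub _ t), ren_sub]
  congr 1
  funext i
  cases i <;> simp [single, scons, shift, ren]

end Tm

theorem reflTransGen_pi {ι : Type*} [Finite ι] [DecidableEq ι] {T : ι → Type*}
    {P : ∀ i, T i → T i → Prop} {ts us : ∀ i, T i}
    (h : ∀ i, Relation.ReflTransGen (P i) (ts i) (us i)) :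
    Relation.ReflTransGen (fun f g => ∃ i t, P i (f i) t ∧ g = Function.update f i t) ts us := by
  have update_one (f : ∀ i, T i) (i : ι) (t : T i) (ht : Relation.ReflTransGen (P i) (f i) t) :
      Relation.ReflTransGen (fun f g => ∃ i t, P i (f i) t ∧ g = Function.update f i t)
        f (Function.update f i t) := by
    induction ht with
    | refl => rw [Function.update_eq_self]
    | @tail b c _ hbc ih => exact ih.tail ⟨i, c, by simpa using hbc, by simp⟩
  have := Fintype.ofFinite ι
  have update_on (s : Finset ι) : Relation.ReflTransGen
      (fun f g => ∃ i t, P i (f i) t ∧ g = Function.update f i t) ts (s.piecewise us ts) := by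
    induction s using Finset.induction_on with
    | empty => rw [Finset.piecewise_empty]
    | insert i s hi ih =>
      rw [Finset.piecewise_insert]
      exact ih.trans (update_one _ _ _ (by simpa [hi] using h i))
  simpa using update_on Finset.univ

namespace Tm

variable {S : Signature}

theorem repl_sub_single (i : ℕ) (v t : Tm S) :
    Relation.ReflTransGen (Repl i v) t (sub (single i v) t) := by
  induction t generalizing i v with
  | var j =>
    rcases eq_or_ne j i with rfl | h
    · simpa [sub, single] using Relation.ReflTransGen.single Repl.here
    · simpa [sub, single, h] using Relation.ReflTransGen.refl
  | num r => exact .refl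
  | lam a t ih =>
    simp only [sub, liftS_single]
    exact (ih (i + 1) (shift 1 v)).lift (lam a) fun _ _ => .lam
  | app t u iht ihu =>
    exact ((iht i v).lift (app · u) fun _ _ => .app_left).trans
      ((ihu i v).lift (app _) fun _ _ => .app_right)
  | pair t u iht ihu =>
    exact ((iht i v).lift (pair · u) fun _ _ => .pair_left).trans
      ((ihu i v).lift (pair _) fun _ _ => .pair_right)
  | letp A B t u iht ihu =>
    simp only [sub, liftS_single, shift_one_shift_one]
    exact ((iht (i + 2) (shift 2 v)).lift (letp A B · u) fun _ _ => .letp_body).trans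
      ((ihu i v).lift (letp A B _) fun _ _ => .letp_arg)
  | esub a t u iht ihu =>
    simp only [sub, liftS_single]
    exact ((iht (i + 1) (shift 1 v)).lift (esub a · u) fun _ _ => .esub_body).trans
      ((ihu i v).lift (esub a _) fun _ _ => .esub_arg)
  | add t u iht ihu =>
    exact ((iht i v).lift (add · u) fun _ _ => .add_left).trans
      ((ihu i v).lift (add _) fun _ _ => .add_right)
  | fn f ts ih =>
    refine (reflTransGen_pi fun j => ih j i v).lift (fn f) ?_
    rintro us _ ⟨j, t, h, rfl⟩
    exact .fn h

end Tm

/-! ### Evaluation -/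

theorem SCtx.add_size_nil {S : Signature} : (fun i => i + size ([] : SCtx S)) = id := rfl

theorem SCtx.compAll_nil {S : Signature} (k : ℕ) : compAll k (fun _ => ([] : SCtx S)) = [] := by
  induction k with
  | zero => rfl
  | succ k ih => simp only [compAll, ih]; rfl

namespace Reduces

open Tm

variable {S : Signature} {Γ : List Ann}

theorem refl (t : Tm S) : Reduces Γ t t := Relation.ReflTransGen.refl

theorem trans {t u v : Tm S} (h : Reduces Γ t u) (h' : Reduces Γ u v) : Reduces Γ t v :=
  Relation.ReflTransGen.trans h h'

instance : Trans (Reduces (S := S) Γ) (Reduces Γ) (Reduces Γ) := ⟨trans⟩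

theorem of_root {t u : Tm S} (h : Root Γ t u) : Reduces Γ t u :=
  Relation.ReflTransGen.single (.inl (.root h))

theorem of_sumEq {t u : Tm S} (h : SumEq Γ t u) : Reduces Γ t u :=
  Relation.ReflTransGen.single (.inr (.root h))

theorem congr {Δ : List Ann} (f : Tm S → Tm S)
    (hf : ∀ (P : List Ann → Tm S → Tm S → Prop) (t u : Tm S),
      CtxClosure P Δ t u → CtxClosure P Γ (f t) (f u))
    {t u : Tm S} (h : Reduces Δ t u) : Reduces Γ (f t) (f u) :=
  Relation.ReflTransGen.lift f (fun _ _ => Or.imp (hf _ _ _) (hf _ _ _)) _ _ h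

theorem app {t t' u u' : Tm S} (h : Reduces Γ t t') (h' : Reduces Γ u u') :
    Reduces Γ (.app t u) (.app t' u') :=
  (h.congr (Tm.app · u) fun _ _ _ => .app_left).trans
    (h'.congr (Tm.app t') fun _ _ _ => .app_right)

theorem pair {t t' u u' : Tm S} (h : Reduces Γ t t') (h' : Reduces Γ u u') :
    Reduces Γ (.pair t u) (.pair t' u') :=
  (h.congr (Tm.pair · u) fun _ _ _ => .pair_left).trans
    (h'.congr (Tm.pair t') fun _ _ _ => .pair_right)

theorem letp_arg (A B : Ty) (t : Tm S) {u u' : Tm S} (h : Reduces Γ u u') :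
    Reduces Γ (.letp A B t u) (.letp A B t u') :=
  h.congr (Tm.letp A B t) fun _ _ _ => .letp_arg

theorem esub_arg (a : Ann) (t : Tm S) {u u' : Tm S} (h : Reduces Γ u u') :
    Reduces Γ (.esub a t u) (.esub a t u') :=
  h.congr (Tm.esub a t) fun _ _ _ => .esub_arg

theorem add {t t' u u' : Tm S} (h : Reduces Γ t t') (h' : Reduces Γ u u') :
    Reduces Γ (.add t u) (.add t' u') :=
  (h.congr (Tm.add · u) fun _ _ _ => .add_left).trans
    (h'.congr (Tm.add t') fun _ _ _ => .add_right)

theorem fn {k : ℕ} (f : S.F' k) {ts us : Fin k → Tm S} (h : ∀ i, Reduces Γ (ts i) (us i)) :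
    Reduces Γ (.fn f ts) (.fn f us) := by
  refine (reflTransGen_pi h).lift (Tm.fn f) ?_
  rintro ts' _ ⟨i, t, h, rfl⟩
  exact h.imp .fn .fn

theorem esub_exp_of_repl (A : Ty) {t t' v : Tm S} (hv : v.IsValue)
    (h : Relation.ReflTransGen (Repl 0 (shift 1 v)) t t') :
    Reduces Γ (.esub (.exp A) t v) (.esub (.exp A) t' v) := by
  refine h.lift' (Tm.esub (.exp A) · v) fun t t' h => of_root (Root.subst A t t' v [] hv ?_)
  rwa [SCtx.add_size_nil, liftR_id, ren_id]

theorem esub_exp (A : Ty) (t : Tm S) {v : Tm S} (hv : v.IsValue) :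
    Reduces Γ (.esub (.exp A) t v) (sub (scons v var) t) :=
  calc
    Reduces Γ (.esub (.exp A) t v) (.esub (.exp A) (shift 1 (sub (scons v var) t)) v) := by
      rw [← sub_single_zero_shift]
      exact esub_exp_of_repl A hv (repl_sub_single _ _ _)
    Reduces Γ _ (shift 0 (sub (scons v var) t)) := of_root (Root.gc A _ v [] hv)
    _ = _ := shift_zero _

theorem esub_lin (t : Tm S) {v : Tm S} (hv : v.IsValue) :
    Reduces Γ (.esub .lin t v) (sub (scons v var) t) := by
  have h := of_root (Root.lin (Γ := Γ) t v [] hv)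
  rwa [SCtx.add_size_nil, liftR_id, ren_id, inst_eq_sub_scons] at h

theorem esub (a : Ann) (t : Tm S) {v : Tm S} (hv : v.IsValue) :
    Reduces Γ (.esub a t v) (sub (scons v var) t) := by
  cases a with
  | exp A => exact esub_exp A t hv
  | lin => exact esub_lin t hv

theorem esub_sub_liftS (a : Ann) (s : ℕ → Tm S) (t : Tm S) {v : Tm S} (hv : v.IsValue) :
    Reduces Γ (.esub a (sub (liftS s) t) v) (sub (scons v s) t) := by
  rw [← sub_scons_var_sub_liftS]
  exact esub a _ hv

theorem app_lam_sub_liftS (a : Ann) (s : ℕ → Tm S) (t : Tm S) {v : Tm S} (hv : v.IsValue) :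
    Reduces Γ (.app (.lam a (sub (liftS s) t)) v) (sub (scons v s) t) := by
  have h := of_root (Root.beta (Γ := Γ) a (sub (liftS s) t) v [])
  simp only [SCtx.size, SCtx.plug, shift_zero] at h
  exact h.trans (esub_sub_liftS a s t hv)

theorem letp_pair_sub_liftS (A B : Ty) (s : ℕ → Tm S) (t : Tm S) {v w : Tm S} (hv : v.IsValue)
    (hw : w.IsValue) :
    Reduces Γ (.letp A B (sub (liftS (liftS s)) t) (.pair v w))
      (sub (scons v (scons w s)) t) := by
  have h := of_root (Root.unpair (Γ := Γ) A B (sub (liftS (liftS s)) t) v w [])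
  simp only [SCtx.add_size_nil, SCtx.plug, liftRN, liftR_id, ren_id] at h
  refine h.trans ((esub (.exp B) _ hw).trans ?_)
  simp only [sub, sub_scons_shift, sub_var, sub_liftS_scons_var_sub_liftS]
  exact esub_sub_liftS _ _ _ hv

theorem fn_num {k : ℕ} (f : S.F' k) (r : Fin k → ℝ) :
    Reduces Γ (.fn f fun i => .num (r i)) (.num (S.sem f r)) := by
  have h := of_root (Root.fn (Γ := Γ) f r fun _ => [])
  rwa [SCtx.compAll_nil] at h

theorem mul_num {t u : Tm S} {x y : ℝ} (ht : Reduces Γ t (.num x)) (hu : Reduces Γ u (.num y)) :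
    Reduces Γ (.mul t u) (.num (x * y)) := by
  refine (fn (us := fun i => .num (![x, y] i)) _ ?_).trans ?_
  · simpa [Fin.forall_fin_two] using ⟨ht, hu⟩
  · simpa [S.sem_mul] using fn_num (Γ := Γ) (S.incl S.mul) ![x, y]

theorem add_num (x y : ℝ) : Reduces Γ (.add (.num x) (.num y) : Tm S) (.num (x + y)) :=
  of_root (Root.plus x y [] [])

end Reduces

/-! ### Finite sums -/

namespace Reduces

open Tm

variable {S : Signature} {Γ : List Ann} {d : ℕ}

theorem add_comm (t u : Tm S) : Reduces Γ (.add t u) (.add u t) := of_sumEq (.comm t u)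

theorem add_assoc (s t u : Tm S) : Reduces Γ (.add (.add s t) u) (.add s (.add t u)) :=
  of_sumEq (.assoc s t u)

theorem add_left_comm (s t u : Tm S) : Reduces Γ (.add s (.add t u)) (.add t (.add s u)) :=
  calc
    Reduces Γ _ (.add (.add t u) s) := add_comm _ _
    Reduces Γ _ (.add t (.add u s)) := add_assoc _ _ _
    Reduces Γ _ (.add t (.add s u)) := (refl t).add (add_comm u s)

theorem add_assoc_symm (s t u : Tm S) : Reduces Γ (.add s (.add t u)) (.add (.add s t) u) :=
  calc
    Reduces Γ _ (.add s (.add u t)) := (refl s).add (add_comm t u)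
    Reduces Γ _ (.add u (.add s t)) := add_left_comm _ _ _
    Reduces Γ _ (.add (.add s t) u) := add_comm _ _

theorem add_sum (t : Tm S) (ts : List (Tm S)) :
    Reduces Γ (.add t (sum d ts)) (sum d (t :: ts)) := by
  cases ts with
  | nil => exact of_sumEq (.zero t d)
  | cons u us => exact refl _

theorem sum_add_sum (ts us : List (Tm S)) :
    Reduces Γ (.add (sum d ts) (sum d us)) (sum d (ts ++ us)) := by
  induction ts with
  | nil => exact (add_comm _ _).trans (of_sumEq (.zero _ d))
  | cons t ts ih =>
    cases ts with
    | nil => exact add_sum t us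
    | cons t' ts => exact (add_assoc _ _ _).trans ((refl t).add ih)

theorem sum_forall₂ {ts us : List (Tm S)} (h : List.Forall₂ (Reduces Γ) ts us) :
    Reduces Γ (sum d ts) (sum d us) := by
  induction h with
  | nil => exact refl _
  | cons ht hts ih =>
    cases hts with
    | nil => exact ht
    | cons _ _ => exact ht.add ih

theorem sum_perm {ts us : List (Tm S)} (h : ts.Perm us) : Reduces Γ (sum d ts) (sum d us) := by
  induction h with
  | nil => exact refl _
  | @cons t ts us h ih =>
    cases ts with
    | nil => rw [List.nil_perm.mp h]; exact refl _
    | cons t' ts =>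
      cases us with
      | nil => cases List.perm_nil.mp h
      | cons u us => exact (refl t).add ih
  | swap t u ts =>
    cases ts with
    | nil => exact add_comm u t
    | cons _ _ => exact add_left_comm _ _ _
  | trans _ _ ih ih' => exact ih.trans ih'

theorem sum_cons_cons {t u v : Tm S} (h : Reduces Γ (.add t u) v) (ts : List (Tm S)) :
    Reduces Γ (sum d (t :: u :: ts)) (sum d (v :: ts)) := by
  cases ts with
  | nil => exact h
  | cons _ _ => exact (add_assoc_symm _ _ _).trans (h.add (refl _))

theorem sum_filter_append_filter {ι : Type*} [DecidableEq ι] {J K : Finset ι} {t u v : ι → Tm S}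
    (hJK : ∀ j ∈ J, j ∈ K → Reduces Γ (.add (t j) (u j)) (v j))
    (hJ : ∀ j ∉ K, t j = v j) (hK : ∀ j ∉ J, u j = v j) (l : List ι) (ts : List (Tm S)) :
    Reduces Γ
      (sum d ((l.filter (· ∈ J)).map t ++ ((l.filter (· ∈ K)).map u ++ ts)))
      (sum d ((l.filter (· ∈ J ∪ K)).map v ++ ts)) := by
  induction l generalizing ts with
  | nil => exact refl _
  | cons j l ih =>
    -- Once merged, the summand for `j` is moved into the remainder `ts`.
    have to_head := (ih (v j :: ts)).trans (sum_perm List.perm_middle)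
    have to_tail (us us' : List (Tm S)) :
        (us ++ v j :: (us' ++ ts)).Perm (us ++ (us' ++ v j :: ts)) :=
      .append_left _ List.perm_middle.symm
    by_cases hj : j ∈ J <;> by_cases hk : j ∈ K <;>
      simp only [Finset.mem_union, List.filter_cons, hj, hk, decide_true, decide_false, or_self,
        or_false, false_or, if_true, Bool.false_eq_true, if_false, List.map_cons,
        List.cons_append] at to_head ⊢
    · calc
        Reduces Γ _ _ := sum_perm (List.perm_middle.cons (t j))
        Reduces Γ _ _ := sum_cons_cons (hJK j hj hk) _
        Reduces Γ _ _ := sum_perm (List.perm_middle.symm.trans (to_tail _ _))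
        Reduces Γ _ _ := to_head
    · rw [hJ j hk]
      exact (sum_perm (List.perm_middle.symm.trans (to_tail _ _))).trans to_head
    · rw [hK j hj]
      exact (sum_perm (to_tail _ _)).trans to_head
    · simpa only [Finset.mem_union] using ih ts

theorem app_num_add_app_num {x : ℕ} (hx : Γ[x]? = some (.exp (.neg d))) (p q : ℝ) :
    Reduces Γ (.add (.app (.var x) (.num p)) (.app (.var x) (.num q)) : Tm S)
      (.app (.var x) (.num (p + q))) :=
  (of_root (Root.factor x d (.num p) (.num q) [] [] [] [] hx)).trans
    (app (refl (.var x)) (add_num p q))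

end Reduces

/-- The typing context `x₁* : neg d, …, xₙ* : neg d` of the tags of a gradient. -/
abbrev dualCtx (n d : ℕ) : List Ann := List.replicate n (.exp (.neg d))

namespace taggedSum

variable {S : Signature} {n d : ℕ}

theorem reduces_add {J K : Finset (Fin n)} {g h : Fin n → ℝ} (hg : ∀ j ∉ J, g j = 0)
    (hh : ∀ j ∉ K, h j = 0) :
    Reduces (dualCtx n d) (.add (taggedSum d J g) (taggedSum d K h) : Tm S)
      (taggedSum d (J ∪ K) (g + h)) := by
  refine (Reduces.sum_add_sum _ _).trans ?_
  have merge := Reduces.sum_filter_append_filter (S := S) (Γ := dualCtx n d) (d := d)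
    (J := J) (K := K) (t := fun j : Fin n => .app (.var j) (.num (g j)))
    (u := fun j => .app (.var j) (.num (h j))) (v := fun j => .app (.var j) (.num ((g + h) j)))
    (fun j _ _ => Reduces.app_num_add_app_num (d := d) (by simp) (g j) (h j))
    (fun j hj => by simp [hh j hj]) (fun j hj => by simp [hg j hj]) (List.finRange n) []
  rw [List.append_nil, List.append_nil] at merge
  exact merge

theorem reduces_sum {ι : Type*} [DecidableEq ι] {J : ι → Finset (Fin n)} {g : ι → Fin n → ℝ}
    (hg : ∀ i, ∀ j ∉ J i, g i j = 0) (l : List ι) :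
    Reduces (dualCtx n d) (.sum d (l.map fun i => taggedSum d (J i) (g i)) : Tm S)
      (taggedSum d (l.toFinset.biUnion J) fun j => (l.map (g · j)).sum) := by
  induction l with
  | nil => simpa [taggedSum] using Reduces.refl _
  | cons i l ih =>
    cases l with
    | nil => simpa [Tm.sum] using Reduces.refl (taggedSum d (J i) (g i))
    | cons i' l =>
      rw [List.toFinset_cons, Finset.biUnion_insert]
      refine ((Reduces.refl _).add ih).trans (reduces_add (hg i) fun j hj => ?_)
      refine List.sum_eq_zero fun x hx => ?_
      obtain ⟨i₀, hi₀, rfl⟩ := List.mem_map.mp hx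
      exact hg i₀ j fun hJ => hj (Finset.mem_biUnion.mpr ⟨i₀, List.mem_toFinset.mpr hi₀, hJ⟩)

end taggedSum

/-! ### Iterated explicit substitutions -/

namespace Tm

variable {S : Signature}

/-- The substitution `us 0, …, us (n - 1), s 0, s 1, …`: what `esubs` makes of its bindings. -/
def prepend : (n : ℕ) → (Fin n → Tm S) → (ℕ → Tm S) → ℕ → Tm S
  | 0, _, s => s
  | n + 1, us, s => prepend n (fun i => us i.castSucc) (scons (us (Fin.last n)) s)

theorem prepend_add (n j : ℕ) (us : Fin n → Tm S) (s : ℕ → Tm S) :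
    prepend n us s (n + j) = s j := by
  induction n generalizing s j with
  | zero => simp [prepend]
  | succ n ih => rw [Nat.add_right_comm]; exact ih (j + 1) _ _

theorem prepend_val {n : ℕ} (us : Fin n → Tm S) (s : ℕ → Tm S) (i : Fin n) :
    prepend n us s i = us i := by
  induction n generalizing s with
  | zero => exact i.elim0
  | succ n ih =>
    induction i using Fin.lastCases with
    | last => exact prepend_add n 0 _ _
    | cast i => exact ih _ _ i

/-- The substitution `us 0, ws 0, …, us (k - 1), ws (k - 1), s 0, s 1, …`: what `letPairs` makes
of its bindings. -/
def prependPairs : (k : ℕ) → (Fin k → Tm S) → (Fin k → Tm S) → (ℕ → Tm S) → ℕ → Tm S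
  | 0, _, _, s => s
  | k + 1, us, ws, s => prependPairs k (fun i => us i.castSucc) (fun i => ws i.castSucc)
      (scons (us (Fin.last k)) (scons (ws (Fin.last k)) s))

theorem prependPairs_add (k j : ℕ) (us ws : Fin k → Tm S) (s : ℕ → Tm S) :
    prependPairs k us ws s (2 * k + j) = s j := by
  induction k generalizing s j with
  | zero => simp [prependPairs]
  | succ k ih => rw [Nat.mul_succ, Nat.add_right_comm]; exact ih (j + 2) _ _ _

theorem prependPairs_even {k : ℕ} (us ws : Fin k → Tm S) (s : ℕ → Tm S) (i : Fin k) :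
    prependPairs k us ws s (2 * i) = us i := by
  induction k generalizing s with
  | zero => exact i.elim0
  | succ k ih =>
    induction i using Fin.lastCases with
    | last => exact prependPairs_add k 0 _ _ _
    | cast i => exact ih _ _ _ i

theorem prependPairs_odd {k : ℕ} (us ws : Fin k → Tm S) (s : ℕ → Tm S) (i : Fin k) :
    prependPairs k us ws s (2 * i + 1) = ws i := by
  induction k generalizing s with
  | zero => exact i.elim0
  | succ k ih =>
    induction i using Fin.lastCases with
    | last => exact prependPairs_add k 1 _ _ _
    | cast i => exact ih _ _ _ i

end Tm

namespace Reduces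

open Tm

variable {S : Signature} {Γ : List Ann}

theorem sub_esubs (a : Ann) {n : ℕ} {us : Fin n → Tm S} (s : ℕ → Tm S) (t : Tm S)
    (hus : ∀ i, (sub s (us i)).IsValue) :
    Reduces Γ (sub s (esubs a n us t)) (sub (prepend n (fun i => sub s (us i)) s) t) := by
  induction n generalizing s with
  | zero => exact refl _
  | succ n ih =>
    refine (esub_sub_liftS a s _ (hus (Fin.last n))).trans ?_
    have h := ih (us := fun i => shift 1 (us i.castSucc)) (scons (sub s (us (Fin.last n))) s)
    simp only [sub_scons_shift] at h
    exact h fun i => hus i.castSucc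

theorem sub_letPairs {d k : ℕ} {ts us ws : Fin k → Tm S} (s : ℕ → Tm S) (t : Tm S)
    (hts : ∀ i, Reduces Γ (sub s (ts i)) (.pair (us i) (ws i))) (hus : ∀ i, (us i).IsValue)
    (hws : ∀ i, (ws i).IsValue) :
    Reduces Γ (sub s (letPairs d k ts t)) (sub (prependPairs k us ws s) t) := by
  induction k generalizing s with
  | zero => exact refl _
  | succ k ih =>
    have last_pair := (letp_arg .R (.neg d) _ (hts (Fin.last k))).trans
      (letp_pair_sub_liftS .R (.neg d) s (letPairs d k (fun i => shift 2 (ts i.castSucc)) t)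
        (hus (Fin.last k)) (hws (Fin.last k)))
    refine last_pair.trans (ih _ (fun i => ?_) (fun i => hus i.castSucc) fun i => hws i.castSucc)
    rw [sub_scons_scons_shift]
    exact hts i.castSucc

end Reduces

/-! ### Partial derivatives -/

theorem deriv_comp_update_of_hasFDerivAt {ι : Type*} [Finite ι] [DecidableEq ι]
    {φ : (ι → ℝ) → ℝ} {L : (ι → ℝ) →L[ℝ] ℝ} {x : ι → ℝ} (h : HasFDerivAt φ L x) (i : ι) :
    deriv (fun s => φ (Function.update x i s)) (x i) = L (Pi.single i 1) := by
  have := Fintype.ofFinite ι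
  have h' : HasFDerivAt φ L (Function.update x i (x i)) := by rwa [Function.update_eq_self]
  exact (h'.comp_hasDerivAt (x i) (hasDerivAt_update x i (x i))).deriv

theorem Signature.hasFDerivAt_sem_incl (S : Signature) {k : ℕ} (f : S.F k) (x : Fin k → ℝ) :
    HasFDerivAt (S.sem (S.incl f))
      (∑ i, S.sem (S.par f i) x • ContinuousLinearMap.proj (R := ℝ) (φ := fun _ => ℝ) i) x := by
  have h := (S.differentiable f x).hasFDerivAt
  refine h.congr_fderiv (ContinuousLinearMap.coe_injective (LinearMap.pi_ext' fun i => ?_))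
  refine LinearMap.ext_ring ?_
  simp [S.sem_par, deriv_comp_update_of_hasFDerivAt h, Pi.single_apply]

/-! ### The logical relation -/

/-- The terms `t d`, for all `d` at once, reduce to values `v d` satisfying `P`, in the context of
`n` tags of type `neg d`. A predicate `P` on whole families, rather than on single values, lets the
set of tags in `ComputesTranspose` be the same for all `d`. -/
def EvalsTo {S : Signature} (n : ℕ) (P : (ℕ → Tm S) → Prop) (t : ℕ → Tm S) : Prop :=
  ∃ v, P v ∧ ∀ d, Reduces (dualCtx n d) (t d) (v d)

/-- The values `w d : neg d` compute the transpose `q ↦ ∑ⱼ xⱼ* (q · L eⱼ)` of the linear form `L`.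
Only the summands from some set `J` have to be there, since a tag that does not occur in `w d`
cannot be created by reduction. -/
def ComputesTranspose {S : Signature} {n : ℕ} (w : ℕ → Tm S) (L : (Fin n → ℝ) →L[ℝ] ℝ) : Prop :=
  (∀ d, (w d).IsValue) ∧ ∃ J : Finset (Fin n), (∀ j ∉ J, L (Pi.single j 1) = 0) ∧
    ∀ d q, Reduces (dualCtx n d) (.app (w d) (.num q))
      (taggedSum d J fun j => q * L (Pi.single j 1))

/-- The values `v d` are the dual number of the real function `φ` at `r`: its value there, paired
with the transpose of its derivative. -/
def RealizesReal {S : Signature} {n : ℕ} (r : Fin n → ℝ) (v : ℕ → Tm S)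
    (φ : (Fin n → ℝ) → ℝ) : Prop :=
  ∃ w L, ComputesTranspose w L ∧ HasFDerivAt φ L r ∧ v = fun d => .pair (.num (φ r)) (w d)

/-- The logical relation, for a fixed point `r`, between families of values of type `A.rev d` and
functions from `ℝⁿ` to the denotation of `A`. -/
def Realizes {S : Signature} {n : ℕ} (r : Fin n → ℝ) :
    (A : STy) → (ℕ → Tm S) → ((Fin n → ℝ) → A.sem) → Prop
  | .R, v, φ => RealizesReal r v φ
  | .prod A B, v, φ => ∃ u w, Realizes r A u (fun p => (φ p).1) ∧
      Realizes r B w (fun p => (φ p).2) ∧ v = fun d => .pair (u d) (w d)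
  | .arr A B, v, φ => (∀ d, (v d).IsValue) ∧ ∀ u ψ, Realizes r A u ψ →
      EvalsTo n (Realizes r B · fun p => φ p (ψ p)) fun d => .app (v d) (u d)

/-- The logical relation on contexts: each component of `s` realizes that component of the
environment `γ`, as a function of a point of `ℝⁿ`. -/
def RealizesEnv {S : Signature} {n : ℕ} (r : Fin n → ℝ) (Γ : List STy) (s : ℕ → ℕ → Tm S)
    (γ : (Fin n → ℝ) → Env Γ) : Prop :=
  ∀ ⦃A : STy⦄ (x : Var Γ A), Realizes r A (fun d => s d x.idx) fun p => x.sem (γ p)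

section

open Tm

variable {S : Signature} {n : ℕ}

theorem EvalsTo.of_reduces {P : (ℕ → Tm S) → Prop} {t u : ℕ → Tm S}
    (h : ∀ d, Reduces (dualCtx n d) (t d) (u d)) (hu : EvalsTo n P u) : EvalsTo n P t :=
  let ⟨v, hv, huv⟩ := hu
  ⟨v, hv, fun d => (h d).trans (huv d)⟩

theorem EvalsTo.refl {P : (ℕ → Tm S) → Prop} {v : ℕ → Tm S} (hv : P v) : EvalsTo n P v :=
  ⟨v, hv, fun _ => .refl _⟩

theorem computesTranspose_zero :
    ComputesTranspose (fun d => (.lam .lin (.zeroVec d) : Tm S)) (0 : (Fin n → ℝ) →L[ℝ] ℝ) := by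
  refine ⟨fun _ => .lam _ _, ∅, fun _ _ => rfl, fun d q => ?_⟩
  have h := Reduces.app_lam_sub_liftS (Γ := dualCtx n d) .lin var (.zeroVec d : Tm S) (.num q)
  simpa [sub_zeroVec, taggedSum, Tm.sum] using h

theorem computesTranspose_proj (i : Fin n) :
    ComputesTranspose (fun _ => (.lam .lin (.app (.var (i + 1)) (.var 0)) : Tm S))
      (.proj i : (Fin n → ℝ) →L[ℝ] ℝ) := by
  refine ⟨fun _ => .lam _ _, {i}, fun j hj => ?_, fun d q => ?_⟩
  · rw [Finset.mem_singleton] at hj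
    simp [Ne.symm hj]
  · have h := Reduces.app_lam_sub_liftS (Γ := dualCtx n d) .lin var
      (.app (.var (i + 1)) (.var 0) : Tm S) (.num q)
    have filter_eq : (List.finRange n).filter (fun j => j ∈ ({i} : Finset (Fin n))) = [i] := by
      simp [List.filter_eq, List.nodup_finRange]
    simp only [taggedSum, filter_eq]
    simpa [Tm.sum, liftS_var, sub_var, sub, scons] using h

theorem computesTranspose_sum {k : ℕ} {w : ℕ → Tm S} {ws : Fin k → ℕ → Tm S}
    {L : Fin k → (Fin n → ℝ) →L[ℝ] ℝ} {c : Fin k → ℝ} (hw : ∀ d, (w d).IsValue)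
    (hws : ∀ i, ComputesTranspose (ws i) (L i))
    (h : ∀ d q, Reduces (dualCtx n d) (.app (w d) (.num q))
      (.sum d ((List.finRange k).map fun i => .app (ws i d) (.num (c i * q))))) :
    ComputesTranspose w (∑ i, c i • L i) := by
  choose _ J hJ hsum using hws
  refine ⟨hw, Finset.univ.biUnion J, fun j hj => ?_, fun d q => ?_⟩
  · have zero_of_notMem : ∀ i, L i (Pi.single j 1) = 0 := fun i => hJ i j (by simp_all)
    simp [zero_of_notMem]
  · have hJ_smul : ∀ i, ∀ j ∉ J i, c i * q * L i (Pi.single j 1) = 0 := fun i j hj => by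
      rw [hJ i j hj, mul_zero]
    have merge := taggedSum.reduces_sum (S := S) (d := d) hJ_smul (List.finRange k)
    rw [List.toFinset_finRange] at merge
    have coefficient :
        (fun j => ((List.finRange k).map fun i => c i * q * L i (Pi.single j 1)).sum) =
          fun j => q * (∑ i, c i • L i) (Pi.single j 1) := by
      funext j
      simp [← Fin.sum_univ_def, Finset.mul_sum, mul_assoc, mul_left_comm]
    rw [coefficient] at merge
    refine (h d q).trans ((Reduces.sum_forall₂ ?_).trans merge)
    simpa [List.forall₂_map_left_iff, List.forall₂_map_right_iff, List.forall₂_same] using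
      fun i => hsum i d (c i * q)

theorem Realizes.isValue {r : Fin n → ℝ} {A : STy} {v : ℕ → Tm S} {φ : (Fin n → ℝ) → A.sem}
    (h : Realizes r A v φ) (d : ℕ) : (v d).IsValue := by
  induction A generalizing v with
  | R => obtain ⟨w, L, hw, -, rfl⟩ := h; exact .pair (.num _) (hw.1 d)
  | prod A B ihA ihB => obtain ⟨u, w, hu, hw, rfl⟩ := h; exact .pair (ihA hu) (ihB hw)
  | arr A B => exact h.1 d

theorem realizesReal_const (r : Fin n → ℝ) (q : ℝ) :
    RealizesReal r (fun d => (.pair (.num q) (.lam .lin (.zeroVec d)) : Tm S)) fun _ => q :=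
  ⟨_, 0, computesTranspose_zero, hasFDerivAt_const q r, rfl⟩

theorem realizesReal_proj (r : Fin n → ℝ) (i : Fin n) :
    RealizesReal r (fun _ => (.pair (.num (r i)) (.lam .lin (.app (.var (i + 1)) (.var 0))) : Tm S))
      fun p => p i :=
  ⟨_, _, computesTranspose_proj i, hasFDerivAt_apply i r, rfl⟩

theorem RealizesEnv.cons {r : Fin n → ℝ} {Γ : List STy} {A : STy} {s : ℕ → ℕ → Tm S}
    {γ : (Fin n → ℝ) → Env Γ} {v : ℕ → Tm S} {φ : (Fin n → ℝ) → A.sem} (hv : Realizes r A v φ)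
    (hs : RealizesEnv r Γ s γ) :
    RealizesEnv r (A :: Γ) (fun d => scons (v d) (s d)) fun p => (φ p, γ p)
  | _, .zero => hv
  | _, .succ x => hs x

theorem evalsTo_letPairs {k : ℕ} {r : Fin n → ℝ} {F : (Fin k → ℝ) → ℝ} {c : Fin k → ℝ}
    {φ : Fin k → (Fin n → ℝ) → ℝ} {s : ℕ → ℕ → Tm S} {ts : ℕ → Fin k → Tm S} {b b' : ℕ → Tm S}
    (hF : HasFDerivAt F (∑ i, c i • .proj i : (Fin k → ℝ) →L[ℝ] ℝ) fun i => φ i r)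
    (hts : ∀ i, EvalsTo n (RealizesReal r · (φ i)) fun d => sub (s d) (ts d i))
    (hb : ∀ d σ, (∀ i : Fin k, σ (2 * i) = .num (φ i r)) →
      Reduces (dualCtx n d) (sub σ (b d)) (.num (F fun i => φ i r)))
    (hb' : ∀ d σ q, (∀ i : Fin k, σ (2 * i) = .num (φ i r)) →
      Reduces (dualCtx n d) (sub (scons (.num q) σ) (b' d))
        (.sum d ((List.finRange k).map fun i : Fin k => .app (σ (2 * i + 1)) (.num (c i * q))))) :
    EvalsTo n (RealizesReal r · fun p => F fun i => φ i p) fun d =>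
      sub (s d) (letPairs d k (ts d) (.pair (b d) (.lam .lin (b' d)))) := by
  choose v hv hred using hts
  choose ws L hws hφ hv using hv
  let σ d := prependPairs k (fun i => .num (φ i r)) (fun i => ws i d) (s d)
  have hσ d (i : Fin k) : σ d (2 * i) = .num (φ i r) := prependPairs_even _ _ _ i
  have hσ' d (i : Fin k) : σ d (2 * i + 1) = ws i d := prependPairs_odd _ _ _ i
  refine ⟨fun d => .pair (.num (F fun i => φ i r)) (.lam .lin (sub (liftS (σ d)) (b' d))),
    ⟨_, ∑ i, c i • L i, ?_, ?_, rfl⟩, fun d => ?_⟩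
  · refine computesTranspose_sum (fun _ => .lam _ _) hws fun d q => ?_
    refine (Reduces.app_lam_sub_liftS _ _ _ (.num q)).trans ?_
    simpa only [hσ'] using hb' d (σ d) q (hσ d)
  · refine (hF.comp r (hasFDerivAt_pi.mpr hφ)).congr_fderiv ?_
    ext; simp
  · refine .trans (Reduces.sub_letPairs (us := fun i => .num (φ i r)) (ws := fun i => ws i d)
      (s d) _ (fun i => ?_) (fun _ => .num _) fun i => (hws i).1 d)
      ((hb d (σ d) (hσ d)).pair (.refl _))
    simpa only [hv] using hred i d

theorem evalsTo_rev_fn {Γ : List STy} {k : ℕ} {f : S.F k} {ts : Fin k → STm S Γ .R}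
    {r : Fin n → ℝ} {φ : Fin k → (Fin n → ℝ) → ℝ} {s : ℕ → ℕ → Tm S}
    (hts : ∀ i, EvalsTo n (RealizesReal r · (φ i)) fun d => sub (s d) ((ts i).rev d)) :
    EvalsTo n (RealizesReal r · fun p => S.sem (S.incl f) fun i => φ i p) fun d =>
      sub (s d) ((STm.fn f ts).rev d) := by
  refine evalsTo_letPairs (S.hasFDerivAt_sem_incl f _) hts (fun d σ hσ => ?_) fun d σ q hσ => ?_
  · simp only [sub, hσ]
    exact .fn_num _ _
  · rw [sub_sum, List.map_map]
    refine .sum_forall₂ ?_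
    simp only [List.forall₂_map_left_iff, List.forall₂_map_right_iff, List.forall₂_same]
    refine fun i _ => (Reduces.refl _).app ?_
    rw [sub_mul]
    refine .mul_num ?_ (.refl _)
    simp only [sub, scons, hσ]
    exact .fn_num _ _

theorem evalsTo_rev_add {Γ : List STy} {t u : STm S Γ .R}
    {r : Fin n → ℝ} {φ ψ : (Fin n → ℝ) → ℝ} {s : ℕ → ℕ → Tm S}
    (ht : EvalsTo n (RealizesReal r · φ) fun d => sub (s d) (t.rev d))
    (hu : EvalsTo n (RealizesReal r · ψ) fun d => sub (s d) (u.rev d)) :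
    EvalsTo n (RealizesReal r · fun p => φ p + ψ p) fun d => sub (s d) ((STm.add t u).rev d) := by
  have hF (x : Fin 2 → ℝ) : HasFDerivAt (fun x : Fin 2 → ℝ => x 0 + x 1)
      (∑ i, (1 : ℝ) • .proj i : (Fin 2 → ℝ) →L[ℝ] ℝ) x := by
    rw [Fin.sum_univ_two, one_smul, one_smul]
    exact (hasFDerivAt_apply 0 x).fun_add (hasFDerivAt_apply 1 x)
  refine evalsTo_letPairs (k := 2) (φ := ![φ, ψ]) (ts := fun d => ![t.rev d, u.rev d])
    (b := fun _ => .add (.var 0) (.var 2))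
    (b' := fun _ => .add (.app (.var 2) (.var 0)) (.app (.var 4) (.var 0)))
    (hF _) (Fin.forall_fin_two.mpr ⟨ht, hu⟩) (fun d σ hσ => ?_) fun d σ q _ => ?_
  · have h0 : σ 0 = .num (φ r) := hσ 0
    have h2 : σ 2 = .num (ψ r) := hσ 1
    simp only [sub, h0, h2]
    exact .add_num _ _
  · simpa [sub, scons, Tm.sum, List.finRange_succ] using Reduces.refl _

theorem STm.evalsTo_rev {Γ : List STy} {A : STy} (t : STm S Γ A) {r : Fin n → ℝ}
    {s : ℕ → ℕ → Tm S} {γ : (Fin n → ℝ) → Env Γ} (hs : RealizesEnv r Γ s γ) :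
    EvalsTo n (Realizes r A · fun p => t.sem (γ p)) fun d => sub (s d) (t.rev d) := by
  induction t generalizing s with
  | var x => exact .refl (hs x)
  | num q =>
    refine .of_reduces (fun d => ?_) (.refl (realizesReal_const r q))
    simpa only [STm.rev, sub, sub_zeroVec] using Reduces.refl _
  | lam t ih =>
    refine .refl ⟨fun _ => .lam _ _, fun u ψ hu => ?_⟩
    exact .of_reduces (fun d => .app_lam_sub_liftS _ _ _ (hu.isValue d)) (ih (hs.cons hu))
  | app t u iht ihu =>
    obtain ⟨v, hv, ht⟩ := iht hs
    obtain ⟨w, hw, hu⟩ := ihu hs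
    exact .of_reduces (fun d => (ht d).app (hu d)) (hv.2 w _ hw)
  | pair t u iht ihu =>
    obtain ⟨v, hv, ht⟩ := iht hs
    obtain ⟨w, hw, hu⟩ := ihu hs
    exact .of_reduces (fun d => (ht d).pair (hu d)) (.refl ⟨v, w, hv, hw, rfl⟩)
  | letp t u iht ihu =>
    obtain ⟨_, ⟨v, w, hv, hw, rfl⟩, hu⟩ := ihu hs
    exact .of_reduces (fun d => ((hu d).letp_arg _ _ _).trans
      (.letp_pair_sub_liftS _ _ _ _ (hv.isValue d) (hw.isValue d))) (iht ((hs.cons hw).cons hv))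
  | esub t u iht ihu =>
    obtain ⟨v, hv, hu⟩ := ihu hs
    exact .of_reduces (fun d => ((hu d).esub_arg _ _).trans
      (.esub_sub_liftS _ _ _ (hv.isValue d))) (iht (hs.cons hv))
  | add t u iht ihu => exact evalsTo_rev_add (iht hs) (ihu hs)
  | fn f ts ih => exact evalsTo_rev_fn fun i => ih i hs

end

/-! ### Correctness of the reverse gradient transformation -/

section

open Tm

variable {S : Signature} {n : ℕ}

theorem realizesEnv_realEnv {m : ℕ} {r : Fin n → ℝ} {s : ℕ → ℕ → Tm S}
    {φ : Fin m → (Fin n → ℝ) → ℝ} (h : ∀ i : Fin m, RealizesReal r (fun d => s d i) (φ i)) :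
    RealizesEnv r (realCtx m) s fun p => realEnv m fun i => φ i p := by
  induction m generalizing s with
  | zero => rintro _ ⟨⟩
  | succ m ih =>
    rintro _ (_ | x)
    · exact h 0
    · exact ih (s := fun d i => s d (i + 1)) (fun i => h i.succ) x

theorem STm.evalsTo_rev_prepend (t : STm S (realCtx n) .R) (r : Fin n → ℝ) (s : ℕ → ℕ → Tm S) :
    EvalsTo n (RealizesReal r · t.realFun) fun d =>
      sub (prepend n (fun i => .pair (.num (r i)) (.lam .lin (.app (.var (i + 1)) (.var 0)))) (s d))
        (t.rev d) := by
  refine t.evalsTo_rev (realizesEnv_realEnv (φ := fun i p => p i) fun i => ?_)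
  simpa only [prepend_val] using realizesReal_proj r i

theorem STm.differentiable_realFun (t : STm S (realCtx n) .R) : Differentiable ℝ t.realFun :=
  fun r =>
    let ⟨_, ⟨_, _, _, h, _⟩, _⟩ := t.evalsTo_rev_prepend r fun _ => Tm.var
    h.differentiableAt

/-- The vector of partial derivatives at `r` of the function denoted by `t`, whose tuple of
numerals is `STm.nabla`. -/
noncomputable def STm.gradient (t : STm S (realCtx n) .R) (r : Fin n → ℝ) : Fin n → ℝ :=
  fun i => deriv (fun s => t.realFun (Function.update r i s)) (r i)

theorem STm.gradProgram_reduces_letp (t : STm S (realCtx n) .R) (r : Fin n → ℝ) (Γ : List Ann)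
    (d : ℕ) :
    let σ := prepend n (fun i => .num (r i)) Tm.var
    Reduces Γ (t.gradProgram d r)
      (.letp .R (.neg d) (sub (liftS (liftS σ)) (.app (.var 1) (.num 1)))
        (sub
          (prepend n (fun i => .pair (.num (r i)) (.lam .lin (.app (.var (i + 1)) (.var 0)))) σ)
          (t.rev d))) := by
  intro σ
  have sub_dual (i : Fin n) :
      sub σ (.pair (.var i) (.lam .lin (.app (.var (n + i + 1)) (.var 0)))) =
        .pair (.num (r i)) (.lam .lin (.app (.var (i + 1)) (.var 0))) := by
    simp only [sub, liftS, σ, prepend_val, prepend_add, shift, ren]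
  have numerals := Reduces.sub_esubs (S := S) (Γ := Γ) (.exp .R) (us := fun i => .num (r i)) Tm.var
    (.letp .R (.neg d) (.app (.var 1) (.num 1))
      (esubs (.exp (STy.R.rev d)) n
        (fun i => .pair (.var i) (.lam .lin (.app (.var (n + i + 1)) (.var 0)))) (t.rev d)))
    fun i => .num (r i)
  have duals := Reduces.sub_esubs (Γ := Γ) (.exp (STy.R.rev d)) σ (t.rev d) (us := fun i : Fin n =>
    .pair (.var i) (.lam .lin (.app (.var (n + i + 1)) (.var 0)))) fun i => by
      rw [sub_dual]; exact .pair (.num _) (.lam _ _)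
  simp only [sub_dual] at duals
  rw [sub_var] at numerals
  exact numerals.trans (duals.letp_arg _ _ _)

theorem STm.gradProgram_reduces_taggedSum (t : STm S (realCtx n) .R) (r : Fin n → ℝ) :
    ∃ J : Finset (Fin n), (∀ j ∉ J, t.gradient r j = 0) ∧
      ∀ d, Reduces (dualCtx n d) (t.gradProgram d r) (taggedSum d J (t.gradient r)) := by
  obtain ⟨_, ⟨w, L, ⟨hw, J, hJ, hsum⟩, hL, rfl⟩, hred⟩ :=
    t.evalsTo_rev_prepend r fun _ => prepend n (fun i => .num (r i)) Tm.var
  have gradient_eq : t.gradient r = fun j => L (Pi.single j 1) :=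
    funext fun j => deriv_comp_update_of_hasFDerivAt hL j
  rw [gradient_eq]
  refine ⟨J, hJ, fun d => ?_⟩
  calc
    Reduces (dualCtx n d) _ _ := t.gradProgram_reduces_letp r _ d
    Reduces (dualCtx n d) _ _ := (hred d).letp_arg _ _ _
    Reduces (dualCtx n d) _ (.app (w d) (.num 1)) :=
      .letp_pair_sub_liftS _ _ _ _ (.num _) (hw d)
    Reduces (dualCtx n d) _ _ := by simpa only [one_mul] using hsum d 1

end

/-! ### The recurrent network -/

section

variable {S : Signature}

theorem churchList_sem {Γ : List STy} {X : STy} (l : List ℝ) (γ : Env Γ)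
    (f : ℝ → X.sem → X.sem) (x : X.sem) :
    (churchList S Γ X l).sem γ f x = l.foldr f x := by
  induction l with
  | nil => rfl
  | cons a l ih => exact congrArg (f a) ih

theorem layer_sem {Γ : List STy} {ε ρ : Var Γ .R} {γ : Env Γ} {e r : ℝ} (hε : ε.sem γ = e)
    (hρ : ρ.sem γ = r) :
    (layer S ε ρ).sem γ = fun x h : ℝ => Real.sigmoid (e * x + r * h) := by
  subst hε hρ
  exact funext fun x => funext fun h => (S.sem_sig _).trans <|
    congrArg₂ (fun y z : ℝ => Real.sigmoid (y + z)) (S.sem_mul _) (S.sem_mul _)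

theorem state_eq_foldr (n : ℕ) (a : ℕ → ℝ) (e r : ℝ) {i : ℕ} (hi : i ≤ n) :
    state n a e r i =
      (List.range' (n - i) i).foldr (fun j h => Real.sigmoid (e * a (j + 1) + r * h)) 0 := by
  induction i with
  | zero => rfl
  | succ i ih =>
    have pred_add : n - (i + 1) + 1 = n - i := by omega
    rw [List.range'_succ, List.foldr_cons, pred_add, state, ih (by omega)]

theorem realFun_networkApp (n : ℕ) (a : ℕ → ℝ) (v : Fin 2 → ℝ) :
    (networkApp S n a).realFun v = state n a (v 0) (v 1) n := by
  rw [state_eq_foldr n a _ _ le_rfl, Nat.sub_self, ← List.range_eq_range']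
  refine (churchList_sem _ _ _ _).trans (List.foldr_map.trans ?_)
  exact congrArg (fun f : ℝ → ℝ → ℝ => (List.range n).foldr (fun j => f (a (j + 1))) 0)
    (layer_sem rfl rfl)

theorem hasDerivAt_state (n : ℕ) (a : ℕ → ℝ) {ε ρ : ℝ → ℝ} {ε' ρ' s : ℝ}
    (hε : HasDerivAt ε ε' s) (hρ : HasDerivAt ρ ρ' s) (i : ℕ) :
    HasDerivAt (fun s => state n a (ε s) (ρ s) i)
      (ε' * gradEps n a (ε s) (ρ s) i + ρ' * gradRho n a (ε s) (ρ s) i) s := by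
  induction i with
  | zero => simpa [state, gradEps, gradRho] using hasDerivAt_const s (0 : ℝ)
  | succ i ih =>
    have preactivation := (hε.mul_const (a (n - i))).fun_add (hρ.fun_mul ih)
    refine ((differentiable_sigmoid _).hasDerivAt.comp s preactivation).congr_deriv ?_
    simp only [gradEps, gradRho, dsig]
    ring

theorem gradient_networkApp (n : ℕ) (a : ℕ → ℝ) (e r : ℝ) :
    (networkApp S n a).gradient ![e, r] = ![gradEps n a e r n, gradRho n a e r n] := by
  funext i
  simp only [STm.gradient, realFun_networkApp]
  fin_cases i
  · simpa using (hasDerivAt_state n a (hasDerivAt_id e) (hasDerivAt_const e r) n).deriv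
  · simpa using (hasDerivAt_state n a (hasDerivAt_const r e) (hasDerivAt_id r) n).deriv

end

theorem mainTheorem6 (S : Signature) (n : ℕ) (a : ℕ → ℝ) (e r : ℝ) :
    Differentiable ℝ (fun v : Fin 2 → ℝ => (networkApp S n a).realFun v) ∧
    (networkApp S n a).nabla ![e, r] =
      Tm.pair (Tm.num (gradEps n a e r n)) (Tm.num (gradRho n a e r n)) ∧
    ∃ J : Finset (Fin 2),
      (∀ j, j ∉ J → (![gradEps n a e r n, gradRho n a e r n] : Fin 2 → ℝ) j = 0) ∧
      ∀ d : ℕ, Reduces [Ann.exp (Ty.neg d), Ann.exp (Ty.neg d)]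
        ((networkApp S n a).gradProgram d ![e, r])
        (taggedSum d J ![gradEps n a e r n, gradRho n a e r n]) := by
  have gradient_eq := gradient_networkApp (S := S) n a e r
  refine ⟨(networkApp S n a).differentiable_realFun, ?_, ?_⟩
  · change Tm.pair (.num ((networkApp S n a).gradient ![e, r] 0))
      (.num ((networkApp S n a).gradient ![e, r] 1)) = _
    rw [gradient_eq]
    rfl
  · rw [← gradient_eq]
    exact (networkApp S n a).gradProgram_reduces_taggedSum ![e, r]
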